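/- Let $d\ge 1$ be an integer, let $p\in[1,\infty)$, and let $\phi\colon(0,\infty)\to[0,\infty)$ be a measurable function that is regularly varying at zero with index $\rho\in\mathbb R$, i.e. $\lim_{r\to0^+}\phi(\lambda r)/\phi(r)=\lambda^{\rho}$ for every $\lambda>0$, where $\rho<\min(d,p)$. Let $$\nu(dx)=|x|^{-d}\,\phi(|x|)^{-1}\,dx\qquad\text{on }\mathbb R^d$$ and assume that $\int_{\mathbb R^d}(1\wedge|x|^p)\,\nu(dx)<\infty$. Put $$h_p(r)=\int_{\mathbb R^d}\Bigl(1\wedge\frac{|x|^p}{r^p}\Bigr)\nu(dx),\quad r>0,\qquad \|f\|_{W_p^\nu}=\|f\|_p+\Bigl(\int_{\mathbb R^d}\int_{\mathbb R^d}|f(x+h)-f(x)|^p\,dx\,\nu(dh)\Bigr)^{1/p},$$ let $W_p^\nu$ be the space of measurable functions $f\colon\mathbb R^d\to\mathbb R$ with $\|f\|_{W_p^\nu}<\infty$, and for $E\subset\mathbb R^d$ let $$\operatorname{Cap}_{\nu,p}(E)=\inf\bigl\{\|f\|_{W_p^\nu}^p:\ f\in W_p^\nu,\ E\subset\operatorname{int}\{f\ge1\}\bigr\}.$$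 Then there are constants $c,C>0$, not depending on $x$ and $r$, such that for all $r>0$ and $x\in\mathbb R^d$ $$c\,r^d\bigl(1+h_p(r)\bigr)\le\operatorname{Cap}_{\nu,p}(B(x,r))\le C\,r^d\bigl(1+h_p(r)\bigr),$$ where $B(x,r)$ is the open ball with centre $x$ and radius $r$. -/

import Mathlib

open MeasureTheory Filter Topology
open scoped ENNReal

/-- `φ : (0, ∞) → [0, ∞)` is regularly varying at zero with index `α`:
`φ (l * r) / φ r → l ^ α` as `r → 0+`, for every `l > 0`.
(Only values of `φ` on `(0, ∞)` enter; the case `l = 1` forces `φ r ≠ 0` for all small `r > 0`.) -/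
def RegularlyVaryingAtZero (φ : ℝ → ℝ) (α : ℝ) : Prop :=
  ∀ l : ℝ, 0 < l → Tendsto (fun r : ℝ => φ (l * r) / φ r) (𝓝[>] 0) (𝓝 (l ^ α))

/-- The measure `ν(dx) = |x|^{-d} φ(|x|)^{-1} dx` on `ℝ^d`. The inverses are taken in `[0, ∞]`, so
that the density is `∞` where `φ(|x|) = 0`. -/
noncomputable def radialKernelMeasure (d : ℕ) (φ : ℝ → ℝ) :
    Measure (EuclideanSpace ℝ (Fin d)) :=
  volume.withDensity fun x =>
    (ENNReal.ofReal (‖x‖ ^ d))⁻¹ * (ENNReal.ofReal (φ ‖x‖))⁻¹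

/-- The integrability condition `∫ (1 ∧ |x|^p) ν(dx) < ∞`. -/
def PIntegrable {d : ℕ} (ν : Measure (EuclideanSpace ℝ (Fin d))) (p : ℝ) : Prop :=
  ∫⁻ x, ENNReal.ofReal (min 1 (‖x‖ ^ p)) ∂ν < ∞

/-- The concentration function `h_p(r) = ∫ (1 ∧ |x|^p / r^p) ν(dx)`, for `r > 0`. -/
noncomputable def concentration {d : ℕ} (ν : Measure (EuclideanSpace ℝ (Fin d))) (p r : ℝ) :
    ℝ≥0∞ :=
  ∫⁻ x, ENNReal.ofReal (min 1 (‖x‖ ^ p / r ^ p)) ∂ν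

/-- The seminorm `[f] = (∫ ∫ |f(x+h) - f(x)|^p dx ν(dh))^{1/p}`. -/
noncomputable def nonlocalSeminorm {d : ℕ} (ν : Measure (EuclideanSpace ℝ (Fin d))) (p : ℝ)
    (f : EuclideanSpace ℝ (Fin d) → ℝ) : ℝ≥0∞ :=
  (∫⁻ h, ∫⁻ x, ENNReal.ofReal (|f (x + h) - f x| ^ p) ∂volume ∂ν) ^ (1 / p)

/-- The norm `‖f‖_p + [f]` of the nonlocal Sobolev space `W_p^ν`. -/
noncomputable def nonlocalSobolevNorm {d : ℕ} (ν : Measure (EuclideanSpace ℝ (Fin d))) (p : ℝ)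
    (f : EuclideanSpace ℝ (Fin d) → ℝ) : ℝ≥0∞ :=
  eLpNorm f (ENNReal.ofReal p) volume + nonlocalSeminorm ν p f

/-- The nonlocal Sobolev space `W_p^ν`: (Lebesgue) measurable functions of finite norm. -/
def nonlocalSobolevSpace {d : ℕ} (ν : Measure (EuclideanSpace ℝ (Fin d))) (p : ℝ) :
    Set (EuclideanSpace ℝ (Fin d) → ℝ) :=
  {f | AEStronglyMeasurable f volume ∧ nonlocalSobolevNorm ν p f < ∞}

/-- The capacity of a set `E`: the infimum of `‖f‖^p`, with `‖f‖` the norm of `W_p^ν`, over all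
`f ∈ W_p^ν` such that `E` is contained in the interior of `{f ≥ 1}`. -/
noncomputable def nonlocalCapacity {d : ℕ} (ν : Measure (EuclideanSpace ℝ (Fin d))) (p : ℝ)
    (E : Set (EuclideanSpace ℝ (Fin d))) : ℝ≥0∞ :=
  ⨅ f ∈ {f | f ∈ nonlocalSobolevSpace ν p ∧ E ⊆ interior {x | 1 ≤ f x}},
    nonlocalSobolevNorm ν p f ^ p

/-! The upper bound holds for every measure: test with a cone of height 2 on `B(x, 2r)`, whose
increments by `h` are at most `2 * min 1 (‖h‖ / r)` and live on a set of volume comparable to `r ^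
d`.

For the lower bound let `V = |B(x, r)|`, let `g ≥ 1` on the ball, and let `E k = {g ≥ 2⁻ᵏ}`. A jump
from `E k` to the complement of `E (k + 1)` costs at least `2⁻ᵏ⁻¹`, so the energy is at least `2 ^
(-p (k + 1)) |E k|` times a lower bound of `1 + ν(Aᶜ)` over the translates `A` of `E (k + 1)`. If `1
+ ν(Aᶜ) ≥ c (V / |A|) ^ θ (1 + h_p(r))` with `θ < 1`, some `k` gives a bound of order `V (1 +
h_p(r))`: otherwise `|E k|` would grow too fast for the Chebyshev bound `2 ^ (-p k) |E k| ≤ ‖g‖_p ^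
p` (`exists_rpow_le_of_bounded`, `nonlocalSobolevNorm_ge_of_measurable`).

The decay of `1 + ν(Aᶜ)` comes from dyadic annuli (`exists_concentration_le_measure_compl`). Annulus
`j` has `ν`-mass comparable to `w j = 1 / φ(δ 2⁻ʲ)`, and `w (j + 1) ≤ 2 ^ τ w j` for a fixed `τ`
strictly between `max ρ 0` and `min d p`. Since `τ < p`, `1 + h_p(δ 2⁻ⁿ)` is at most a multiple of a
shifted partial sum `S n` of the weights. A set `A` with `|A|` of order `(δ 2⁻ᵐ) ^ d` takes at most
half of each earlier annulus, so `1 + ν(Aᶜ)` is at least a multiple of `S m`. As `S n ≤ 2 ^ (τ (n -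
m)) S m` for `n ≥ m`, this yields `θ = τ / d`, and `τ < d` makes `θ < 1`. -/

/-! ### Regular variation: comparability of `φ` on dyadic scales. -/

namespace RegularlyVaryingAtZero

lemma eventually_pos {φ : ℝ → ℝ} {ρ : ℝ} (hφ : RegularlyVaryingAtZero φ ρ)
    (hnn : ∀ r : ℝ, 0 < r → 0 ≤ φ r) : ∀ᶠ r in 𝓝[>] (0 : ℝ), 0 < φ r := by
  have h := hφ 1 one_pos
  rw [Real.one_rpow] at h
  filter_upwards [h.eventually (lt_mem_nhds one_pos), self_mem_nhdsWithin] with r hr hr0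
  refine lt_of_le_of_ne (hnn r hr0) fun h0 => ?_
  -- Division by zero gives `0`, which contradicts a quotient `φ r / φ r` close to `1`.
  rw [← h0, div_zero] at hr
  exact lt_irrefl _ hr

/-- Locally uniform comparability of a regularly varying function at comparable arguments. -/
lemma exists_local_bounds {φ : ℝ → ℝ} {ρ : ℝ} (hφ : RegularlyVaryingAtZero φ ρ)
    (hnn : ∀ r : ℝ, 0 < r → 0 ≤ φ r) (hm : Measurable (fun r : Set.Ioi (0 : ℝ) => φ r)) :
    ∃ δ M : ℝ, 0 < δ ∧ 0 < M ∧ ∀ s, 0 < s → s ≤ δ → 0 < φ s ∧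
      ∀ u, 1 / 2 ≤ u → u ≤ 1 → φ (s * u) ≤ M * φ s ∧ φ s ≤ M * φ (s * u) := by
  set M : ℝ := 2 ^ |ρ| + 1 with hM
  have hM0 : 0 < M := by positivity
  -- `φ` is only known to be measurable on `(0, ∞)`; `ψ` is its extension by zero.
  set ψ : ℝ → ℝ := (Set.Ioi (0 : ℝ)).indicator φ with hψ
  have hψm : Measurable ψ := by
    refine measurable_of_restrict_of_restrict_compl (s := Set.Ioi 0) measurableSet_Ioi ?_ ?_
    · convert hm using 2 with r
      exact Set.indicator_of_mem r.2 φ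
    · convert measurable_const (a := (0 : ℝ)) using 2 with r
      exact Set.indicator_of_notMem r.2 φ
  have hψe : ∀ r, 0 < r → ψ r = φ r := fun r hr => Set.indicator_of_mem hr φ
  let W : ℝ → Set ℝ := fun s =>
    Set.Icc (1 / 2) 2 ∩ {v | ¬ (ψ (s * v) ≤ M * ψ s ∧ ψ s ≤ M * ψ (s * v))}
  have hWm : ∀ s, MeasurableSet (W s) := fun s => by
    have h1 : Measurable fun v => ψ (s * v) := hψm.comp (measurable_const_mul s)
    exact measurableSet_Icc.inter ((measurableSet_le h1 measurable_const).inter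
      (measurableSet_le measurable_const (h1.const_mul M))).compl
  -- `W s` collects the ratios `v` at which comparability fails at scale `s`. Each fixed `v`
  -- eventually leaves it because `M⁻¹ < v ^ ρ < M`, so dominated convergence makes its measure
  -- vanish.
  have hlim : Tendsto (fun s => volume (W s)) (𝓝[>] 0) (𝓝 (volume (∅ : Set ℝ))) := by
    refine tendsto_measure_of_tendsto_indicator (𝓝[>] 0) hWm
      (measurableSet_Icc (a := (1 / 2 : ℝ)) (b := 2)) (by simp)
      (Eventually.of_forall fun s => Set.inter_subset_left) fun v => ?_
    by_cases hv : v ∈ Set.Icc (1 / 2 : ℝ) 2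
    swap
    · exact Eventually.of_forall fun s => ⟨fun h => absurd h.1 hv, fun h => h.elim⟩
    have hv0 : 0 < v := by linarith [hv.1]
    have hvM : v ^ ρ < M := by
      have : v ^ ρ ≤ 2 ^ |ρ| := by
        rcases le_total 1 v with h1 | h1
        · exact (Real.rpow_le_rpow_of_exponent_le h1 (le_abs_self ρ)).trans
            (Real.rpow_le_rpow hv0.le hv.2 (abs_nonneg ρ))
        · calc v ^ ρ ≤ v ^ (-|ρ|) :=
                Real.rpow_le_rpow_of_exponent_ge hv0 h1 (neg_abs_le ρ)
            _ ≤ (1 / 2) ^ (-|ρ|) :=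
                Real.rpow_le_rpow_of_nonpos (by norm_num) hv.1 (by simp)
            _ = 2 ^ |ρ| := by
                rw [one_div, Real.inv_rpow (by norm_num), Real.rpow_neg (by norm_num), inv_inv]
      linarith
    have hvM' : M⁻¹ < v ^ ρ := by
      have h2 : M⁻¹ < ((2 : ℝ) ^ |ρ|)⁻¹ := by
        apply inv_strictAnti₀ (by positivity); linarith
      refine h2.trans_le ?_
      rw [← Real.rpow_neg (by norm_num)]
      rcases le_total 1 v with h1 | h1
      · calc (2 : ℝ) ^ (-|ρ|) ≤ v ^ (-|ρ|) :=
              Real.rpow_le_rpow_of_nonpos hv0 hv.2 (by simp)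
          _ ≤ v ^ ρ := Real.rpow_le_rpow_of_exponent_le h1 (neg_abs_le ρ)
      · calc (2 : ℝ) ^ (-|ρ|) = (1 / 2) ^ |ρ| := by
              rw [one_div, Real.inv_rpow (by norm_num), Real.rpow_neg (by norm_num)]
          _ ≤ v ^ |ρ| := Real.rpow_le_rpow (by norm_num) hv.1 (abs_nonneg ρ)
          _ ≤ v ^ ρ := Real.rpow_le_rpow_of_exponent_ge hv0 h1 (le_abs_self ρ)
    filter_upwards [(hφ v hv0).eventually (gt_mem_nhds hvM),
      (hφ v hv0).eventually (lt_mem_nhds hvM'), hφ.eventually_pos hnn, self_mem_nhdsWithin]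
      with s h1 h2 h3 h4
    have h4 : 0 < s := h4
    refine ⟨fun h => (h.2 ?_).elim, fun h => h.elim⟩
    rw [hψe s h4, hψe _ (mul_pos h4 hv0), mul_comm s v]
    rw [div_lt_iff₀ h3] at h1
    rw [lt_div_iff₀ h3, inv_mul_lt_iff₀ hM0] at h2
    exact ⟨h1.le, h2.le⟩
  rw [measure_empty] at hlim
  have hev := (hlim.eventually (gt_mem_nhds (show (0 : ℝ≥0∞) < ENNReal.ofReal (1 / 16) by
    simp))).and (hφ.eventually_pos hnn)
  obtain ⟨δ, hδ, hδs⟩ := mem_nhdsGT_iff_exists_Ioc_subset.1 hev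
  have hδ : 0 < δ := hδ
  refine ⟨δ, M * M, hδ, by positivity, fun s hs hsδ => ⟨(hδs ⟨hs, hsδ⟩).2, fun u hu1 hu2 => ?_⟩⟩
  have hu0 : 0 < u := by linarith
  have hsu : 0 < s * u := mul_pos hs hu0
  have hA := (hδs ⟨hs, hsδ⟩).1
  have hB := (hδs (show s * u ∈ Set.Ioc 0 δ from ⟨hsu, by nlinarith⟩)).1
  -- The two exceptional sets have total measure at most `1/16 + 2/16 < 1`, so some `v` in `[1, 2]`
  -- avoids both. Then `φ (s u v)` is comparable to both `φ s` and `φ (s u)`, at the cost of `M`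
  -- twice.
  obtain ⟨v, hv, hvn⟩ : ∃ v ∈ Set.Icc (1 : ℝ) 2, v ∉ W (s * u) ∪ (fun v => u * v) ⁻¹' W s := by
    by_contra! hcon
    have h1 : volume (Set.Icc (1 : ℝ) 2) ≤
        volume (W (s * u)) + volume ((fun v => u * v) ⁻¹' W s) :=
      (measure_mono hcon).trans (measure_union_le _ _)
    rw [Real.volume_preimage_mul_left hu0.ne', Real.volume_Icc] at h1
    have h2 : ENNReal.ofReal |u⁻¹| * volume (W s) ≤
        ENNReal.ofReal 2 * ENNReal.ofReal (1 / 16) := by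
      gcongr
      · rw [abs_of_pos (by positivity)]
        exact (inv_le_comm₀ hu0 (by norm_num)).2 (by linarith)
    have h3 := h1.trans (add_le_add hB.le h2)
    rw [← ENNReal.ofReal_mul (by norm_num), ← ENNReal.ofReal_add (by norm_num) (by norm_num),
      ENNReal.ofReal_le_ofReal_iff (by norm_num)] at h3
    norm_num at h3
  have hv0 : 0 < v := by linarith [hv.1]
  obtain ⟨a1, a2⟩ := not_not.1 fun h =>
    hvn (Or.inl (show v ∈ W (s * u) from ⟨⟨by linarith [hv.1], hv.2⟩, h⟩))
  obtain ⟨b1, b2⟩ := not_not.1 fun h => hvn (Or.inr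
    (show u * v ∈ W s from ⟨⟨by nlinarith [hv.1], by nlinarith [hv.2]⟩, h⟩))
  rw [← mul_assoc, hψe _ (mul_pos hsu hv0), hψe _ hs] at b1 b2
  rw [hψe _ (mul_pos hsu hv0), hψe _ hsu] at a1 a2
  constructor
  · rw [mul_assoc]
    exact a2.trans (mul_le_mul_of_nonneg_left b1 hM0.le)
  · rw [mul_assoc]
    exact b2.trans (mul_le_mul_of_nonneg_left a1 hM0.le)

end RegularlyVaryingAtZero

/-! ### Upper bound: the cone as a test function. -/

section Upper

variable {d : ℕ}

lemma eLpNorm_rpow_eq_lintegral {p : ℝ} (hp : 1 ≤ p) (f : EuclideanSpace ℝ (Fin d) → ℝ) :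
    eLpNorm f (ENNReal.ofReal p) volume ^ p = ∫⁻ x, ENNReal.ofReal (|f x| ^ p) := by
  have hp0 : 0 < p := by linarith
  rw [eLpNorm_eq_lintegral_rpow_enorm_toReal (by simpa using hp0) ENNReal.ofReal_ne_top,
    ENNReal.toReal_ofReal hp0.le, ← ENNReal.rpow_mul, one_div_mul_cancel hp0.ne', ENNReal.rpow_one]
  refine lintegral_congr fun x => ?_
  rw [← ENNReal.ofReal_rpow_of_nonneg (abs_nonneg _) hp0.le, Real.enorm_eq_ofReal_abs]

lemma nonlocalSeminorm_rpow {p : ℝ} (hp : 1 ≤ p) (ν : Measure (EuclideanSpace ℝ (Fin d)))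
    (f : EuclideanSpace ℝ (Fin d) → ℝ) :
    nonlocalSeminorm ν p f ^ p = ∫⁻ h, ∫⁻ x, ENNReal.ofReal (|f (x + h) - f x| ^ p) ∂volume ∂ν := by
  have hp0 : 0 < p := by linarith
  rw [nonlocalSeminorm, ← ENNReal.rpow_mul, one_div_mul_cancel hp0.ne', ENNReal.rpow_one]

/-- The cone of height `2` over the ball `B(x, 2r)`. -/
noncomputable def coneFunction (x : EuclideanSpace ℝ (Fin d)) (r : ℝ)
    (y : EuclideanSpace ℝ (Fin d)) : ℝ :=
  max 0 (2 - ‖y - x‖ / r)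

lemma coneFunction_nonneg (x : EuclideanSpace ℝ (Fin d)) (r : ℝ) (y : EuclideanSpace ℝ (Fin d)) :
    0 ≤ coneFunction x r y := le_max_left _ _

lemma coneFunction_le_two (x : EuclideanSpace ℝ (Fin d)) {r : ℝ} (hr : 0 < r)
    (y : EuclideanSpace ℝ (Fin d)) : coneFunction x r y ≤ 2 :=
  max_le (by norm_num) (by have : 0 ≤ ‖y - x‖ / r := by positivity
                           linarith)

lemma continuous_coneFunction (x : EuclideanSpace ℝ (Fin d)) (r : ℝ) :
    Continuous (coneFunction x r) := by
  unfold coneFunction; fun_prop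

lemma coneFunction_eq_zero {x : EuclideanSpace ℝ (Fin d)} {r : ℝ} (hr : 0 < r)
    {y : EuclideanSpace ℝ (Fin d)} (hy : y ∉ Metric.ball x (2 * r)) : coneFunction x r y = 0 := by
  rw [Metric.mem_ball, dist_eq_norm, not_lt, ← le_div_iff₀ hr] at hy
  exact max_eq_left (by linarith)

lemma abs_coneFunction_sub_le (x : EuclideanSpace ℝ (Fin d)) {r : ℝ} (hr : 0 < r)
    (y h : EuclideanSpace ℝ (Fin d)) :
    |coneFunction x r (y + h) - coneFunction x r y| ≤ 2 * min 1 (‖h‖ / r) := by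
  have h1 : |coneFunction x r (y + h) - coneFunction x r y| ≤ ‖h‖ / r := by
    unfold coneFunction
    refine (abs_max_sub_max_le_max _ _ _ _).trans ?_
    rw [sub_self, abs_zero, max_eq_right (abs_nonneg _)]
    rw [sub_sub_sub_cancel_left, ← sub_div, abs_div, abs_of_pos hr]
    gcongr
    refine (abs_norm_sub_norm_le _ _).trans ?_
    rw [← norm_neg h]
    exact le_of_eq (by congr 1; abel)
  have h2 : |coneFunction x r (y + h) - coneFunction x r y| ≤ 2 := by
    rw [abs_le]
    constructor <;> linarith [coneFunction_nonneg x r (y + h), coneFunction_nonneg x r y,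
      coneFunction_le_two x hr (y + h), coneFunction_le_two x hr y]
  have h3 : 0 ≤ ‖h‖ / r := by positivity
  rcases le_total 1 (‖h‖ / r) with h4 | h4
  · rw [min_eq_left h4]; linarith
  · rw [min_eq_right h4]; linarith

lemma volume_ball_eq (x : EuclideanSpace ℝ (Fin d)) {r : ℝ} (hr : 0 < r) :
    volume (Metric.ball x r) =
      ENNReal.ofReal (r ^ d * volume.real (Metric.ball (0 : EuclideanSpace ℝ (Fin d)) 1)) := by
  rw [Measure.addHaar_ball_of_pos _ _ hr, finrank_euclideanSpace_fin,
    ENNReal.ofReal_mul (by positivity), ofReal_measureReal measure_ball_lt_top.ne]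

lemma lintegral_coneFunction_le {p : ℝ} (hp : 1 ≤ p) (x : EuclideanSpace ℝ (Fin d)) {r : ℝ}
    (hr : 0 < r) :
    ∫⁻ y, ENNReal.ofReal (|coneFunction x r y| ^ p) ≤
      ENNReal.ofReal (2 ^ p) * volume (Metric.ball x (2 * r)) := by
  rw [← setLIntegral_const, ← lintegral_indicator measurableSet_ball]
  refine lintegral_mono fun y => ?_
  by_cases hy : y ∈ Metric.ball x (2 * r)
  · rw [Set.indicator_of_mem hy]
    refine ENNReal.ofReal_le_ofReal (Real.rpow_le_rpow (abs_nonneg _) ?_ (by linarith))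
    rw [abs_of_nonneg (coneFunction_nonneg _ _ _)]
    exact coneFunction_le_two x hr y
  · rw [coneFunction_eq_zero hr hy, abs_zero, Real.zero_rpow (by linarith), ENNReal.ofReal_zero]
    exact zero_le

/-- The increment vanishes unless `y` or `y + h` lies in `B(x, 2r)`, a set of volume at most twice
that of the ball. -/
lemma lintegral_coneFunction_sub_le {p : ℝ} (hp : 1 ≤ p) (x : EuclideanSpace ℝ (Fin d)) {r : ℝ}
    (hr : 0 < r) (h : EuclideanSpace ℝ (Fin d)) :
    ∫⁻ y, ENNReal.ofReal (|coneFunction x r (y + h) - coneFunction x r y| ^ p) ≤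
      ENNReal.ofReal (2 ^ p) * (2 * volume (Metric.ball x (2 * r))) *
        ENNReal.ofReal (min 1 (‖h‖ ^ p / r ^ p)) := by
  have hp0 : 0 < p := by linarith
  set S := (fun y => y + h) ⁻¹' Metric.ball x (2 * r) ∪ Metric.ball x (2 * r)
  have hS : volume S ≤ 2 * volume (Metric.ball x (2 * r)) := by
    refine (measure_union_le _ _).trans ?_
    rw [measure_preimage_add_right, ← two_mul]
  have hSm : MeasurableSet S :=
    (measurableSet_ball.preimage (measurable_add_const h)).union measurableSet_ball
  calc _ ≤ ∫⁻ y, S.indicator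
        (fun _ => ENNReal.ofReal (2 ^ p) * ENNReal.ofReal (min 1 (‖h‖ ^ p / r ^ p))) y := by
        refine lintegral_mono fun y => ?_
        by_cases hy : y ∈ S
        · rw [Set.indicator_of_mem hy, ← ENNReal.ofReal_mul (by positivity)]
          refine ENNReal.ofReal_le_ofReal ?_
          refine (Real.rpow_le_rpow (abs_nonneg _) (abs_coneFunction_sub_le x hr y h)
            hp0.le).trans ?_
          rw [Real.mul_rpow (by norm_num) (by positivity)]
          gcongr
          refine le_min (Real.rpow_le_one (by positivity) (min_le_left _ _) hp0.le) ?_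
          rw [← Real.div_rpow (norm_nonneg _) hr.le]
          exact Real.rpow_le_rpow (by positivity) (min_le_right _ _) hp0.le
        · have h1 : y + h ∉ Metric.ball x (2 * r) := fun h1 => hy (Or.inl h1)
          have h2 : y ∉ Metric.ball x (2 * r) := fun h1 => hy (Or.inr h1)
          rw [coneFunction_eq_zero hr h1, coneFunction_eq_zero hr h2, sub_zero, abs_zero,
            Real.zero_rpow hp0.ne', ENNReal.ofReal_zero]
          exact zero_le
    _ = ENNReal.ofReal (2 ^ p) * ENNReal.ofReal (min 1 (‖h‖ ^ p / r ^ p)) * volume S := by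
        rw [lintegral_indicator hSm, setLIntegral_const]
    _ ≤ ENNReal.ofReal (2 ^ p) * ENNReal.ofReal (min 1 (‖h‖ ^ p / r ^ p)) *
          (2 * volume (Metric.ball x (2 * r))) := by gcongr
    _ = _ := by ring

lemma nonlocalSobolevNorm_coneFunction_le {p : ℝ} (hp : 1 ≤ p)
    (ν : Measure (EuclideanSpace ℝ (Fin d))) (x : EuclideanSpace ℝ (Fin d)) {r : ℝ} (hr : 0 < r) :
    nonlocalSobolevNorm ν p (coneFunction x r) ^ p ≤
      ENNReal.ofReal (2 ^ (2 * p) * 2 ^ d *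
        volume.real (Metric.ball (0 : EuclideanSpace ℝ (Fin d)) 1) * r ^ d) *
        (1 + concentration ν p r) := by
  have hp0 : 0 < p := by linarith
  set D := volume (Metric.ball x (2 * r)) with hD
  have h2 : nonlocalSeminorm ν p (coneFunction x r) ^ p ≤
      ENNReal.ofReal (2 ^ p) * (2 * D) * concentration ν p r := by
    rw [nonlocalSeminorm_rpow hp, concentration, ← lintegral_const_mul']
    · exact lintegral_mono fun h => lintegral_coneFunction_sub_le hp x hr h
    · exact ENNReal.mul_ne_top ENNReal.ofReal_ne_top
        (ENNReal.mul_ne_top (by simp) measure_ball_lt_top.ne)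
  have h1 := lintegral_coneFunction_le hp x hr
  rw [← eLpNorm_rpow_eq_lintegral hp, ← hD] at h1
  calc _ ≤ (2 : ℝ≥0∞) ^ (p - 1) * (eLpNorm (coneFunction x r) (ENNReal.ofReal p) volume ^ p +
          nonlocalSeminorm ν p (coneFunction x r) ^ p) :=
        ENNReal.rpow_add_le_mul_rpow_add_rpow _ _ hp
    _ ≤ (2 : ℝ≥0∞) ^ (p - 1) * (ENNReal.ofReal (2 ^ p) * (2 * D) * 1 +
          ENNReal.ofReal (2 ^ p) * (2 * D) * concentration ν p r) := by
        gcongr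
        refine h1.trans ?_
        rw [mul_one, two_mul]
        gcongr
        exact le_self_add
    _ = ENNReal.ofReal (2 ^ (p - 1) * 2 ^ p * 2) * D * (1 + concentration ν p r) := by
        rw [ENNReal.ofReal_mul (by positivity), ENNReal.ofReal_mul (by positivity),
          ← ENNReal.ofReal_rpow_of_pos (p := p - 1) two_pos]
        simp only [ENNReal.ofReal_ofNat]
        ring
    _ = _ := by
        rw [hD, volume_ball_eq x (by positivity), ← ENNReal.ofReal_mul (by positivity)]
        congr 2
        rw [two_mul p, Real.rpow_add two_pos, Real.rpow_sub two_pos, Real.rpow_one, mul_pow]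
        ring

/-- The upper bound for the capacity of a ball, for an arbitrary measure. -/
theorem nonlocalCapacity_ball_le {p : ℝ} (hp : 1 ≤ p) (ν : Measure (EuclideanSpace ℝ (Fin d)))
    (x : EuclideanSpace ℝ (Fin d)) {r : ℝ} (hr : 0 < r) :
    nonlocalCapacity ν p (Metric.ball x r) ≤
      ENNReal.ofReal (2 ^ (2 * p) * 2 ^ d *
        volume.real (Metric.ball (0 : EuclideanSpace ℝ (Fin d)) 1) * r ^ d) *
        (1 + concentration ν p r) := by
  have hp0 : 0 < p := by linarith
  have hle := nonlocalSobolevNorm_coneFunction_le hp ν x hr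
  -- With infinite concentration the cone need not lie in the space, but the right-hand side is then
  -- infinite.
  by_cases htop : concentration ν p r = ∞
  · have hω : 0 < volume.real (Metric.ball (0 : EuclideanSpace ℝ (Fin d)) 1) :=
      ENNReal.toReal_pos (Metric.measure_ball_pos _ _ one_pos).ne' measure_ball_lt_top.ne
    rw [htop, add_top, ENNReal.mul_top]
    · exact le_top
    · simp only [ne_eq, ENNReal.ofReal_eq_zero, not_le]
      positivity
  refine (iInf₂_le (coneFunction x r) ⟨⟨(continuous_coneFunction x r).aestronglyMeasurable, ?_⟩,
    ?_⟩).trans hle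
  · rw [← ENNReal.rpow_lt_top_iff_of_pos hp0]
    exact hle.trans_lt (ENNReal.mul_lt_top ENNReal.ofReal_lt_top
      (ENNReal.add_lt_top.2 ⟨ENNReal.one_lt_top, lt_top_iff_ne_top.2 htop⟩))
  · refine interior_maximal (fun y hy => ?_) Metric.isOpen_ball
    rw [Metric.mem_ball, dist_eq_norm, ← div_lt_one hr] at hy
    exact le_max_of_le_right (by linarith : (1 : ℝ) ≤ 2 - ‖y - x‖ / r)

end Upper

/-! ### Lower bound from the decay of `1 + ν(Aᶜ)`. -/

section Lower

/-- If `2 ^ (-p k) b k` is bounded then `b` cannot grow superexponentially, so that at some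
index the next value is controlled by the present one. -/
lemma exists_rpow_le_of_bounded {p θ X : ℝ} (hp : 0 < p) (hθ : 0 < θ) (hθ1 : θ < 1) {b : ℕ → ℝ}
    (hb : ∀ k, 0 < b k) (hb0 : 1 ≤ b 0) (hX : ∀ k : ℕ, 2 ^ (-(p * k)) * b k ≤ X) :
    ∃ k : ℕ, 2 ^ (-(θ * (p / (1 - θ)))) * b (k + 1) ^ θ ≤ 2 ^ (-(p * k)) * b k := by
  by_contra! hcon
  -- `B` is the growth rate fixed by the reversed recursion: `B - p = θ * B`. That recursion forces
  -- `b k ≥ 2 ^ (B k)`, hence `2 ^ (-(p k)) * b k ≥ 2 ^ (θ B k)`, which is unbounded.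
  set B := p / (1 - θ) with hB
  have hBp : B - p = θ * B := by
    rw [hB]; field_simp [(by linarith : (1 - θ) ≠ 0)]; ring
  have hB0 : 0 < B := div_pos hp (by linarith)
  have hgrow : ∀ k : ℕ, (2 : ℝ) ^ (B * k) ≤ b k := by
    intro k
    induction k with
    | zero => simpa using hb0
    | succ k ih =>
      have h1 := hcon k
      have h2 : (2 : ℝ) ^ (θ * (B * (k + 1))) ≤ b (k + 1) ^ θ := by
        calc (2 : ℝ) ^ (θ * (B * (k + 1)))
            = 2 ^ (θ * B) * (2 ^ (-(p * k)) * 2 ^ (B * k)) := by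
              rw [← Real.rpow_add two_pos, ← Real.rpow_add two_pos]
              congr 1
              linear_combination -(k : ℝ) * hBp
          _ ≤ 2 ^ (θ * B) * (2 ^ (-(p * k)) * b k) := by gcongr
          _ ≤ 2 ^ (θ * B) * (2 ^ (-(θ * B)) * b (k + 1) ^ θ) := by gcongr
          _ = b (k + 1) ^ θ := by
              rw [← mul_assoc, ← Real.rpow_add two_pos, add_neg_cancel, Real.rpow_zero, one_mul]
      rw [mul_comm θ, Real.rpow_mul two_pos.le] at h2
      push_cast
      exact (Real.rpow_le_rpow_iff (by positivity) (hb _).le hθ).1 h2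
  have hq : (1 : ℝ) < 2 ^ (θ * B) := Real.one_lt_rpow one_lt_two (by positivity)
  obtain ⟨k, hk⟩ := pow_unbounded_of_one_lt X hq
  refine absurd (hX k) (not_le.2 (hk.trans_le ?_))
  calc ((2 : ℝ) ^ (θ * B)) ^ k = 2 ^ (-(p * k)) * 2 ^ (B * k) := by
        rw [← Real.rpow_natCast, ← Real.rpow_mul two_pos.le, ← Real.rpow_add two_pos]
        congr 1
        linear_combination -(k : ℝ) * hBp
    _ ≤ _ := by gcongr; exact hgrow k

variable {d : ℕ}

/-- The energy of a function is bounded below by the interaction between a superlevel set and the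
complement of a lower superlevel set. -/
lemma lintegral_add_lintegral_ge {p : ℝ} (hp : 1 ≤ p) (ν : Measure (EuclideanSpace ℝ (Fin d)))
    [SFinite ν] {g : EuclideanSpace ℝ (Fin d) → ℝ} (hg : Measurable g) (k : ℕ) {m : ℝ≥0∞}
    (hm : ∀ x, m ≤ 1 + ν ((fun h => x + h) ⁻¹' {y | 2⁻¹ ^ (k + 1) ≤ g y})ᶜ) :
    ENNReal.ofReal ((2⁻¹ ^ (k + 1)) ^ p) * (m * volume {y | 2⁻¹ ^ k ≤ g y}) ≤
      (∫⁻ x, ENNReal.ofReal (|g x| ^ p)) +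
        ∫⁻ h, ∫⁻ x, ENNReal.ofReal (|g (x + h) - g x| ^ p) ∂volume ∂ν := by
  have hp0 : 0 < p := by linarith
  have hmeas : Measurable (fun q : EuclideanSpace ℝ (Fin d) × EuclideanSpace ℝ (Fin d) =>
      ENNReal.ofReal (|g (q.2 + q.1) - g q.2| ^ p)) := by fun_prop
  rw [lintegral_lintegral_swap hmeas.aemeasurable, ← lintegral_add_left (by fun_prop)]
  have hE : MeasurableSet {y | 2⁻¹ ^ k ≤ g y} := measurableSet_le measurable_const hg
  have hF : MeasurableSet {y | 2⁻¹ ^ (k + 1) ≤ g y} := measurableSet_le measurable_const hg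
  rw [← setLIntegral_const, ← lintegral_indicator hE,
    ← lintegral_const_mul' _ _ ENNReal.ofReal_ne_top]
  refine lintegral_mono fun x => ?_
  by_cases hx : x ∈ {y | 2⁻¹ ^ k ≤ g y}
  swap
  · rw [Set.indicator_of_notMem hx, mul_zero]; exact zero_le
  rw [Set.indicator_of_mem hx]
  have hx : 2⁻¹ ^ k ≤ g x := hx
  have hpos : (0 : ℝ) < 2⁻¹ ^ k := by positivity
  refine (mul_le_mul_right (hm x) _).trans ?_
  rw [mul_add, mul_one]
  -- The summand `1` is paid for by the `L^p` part at `x`, the summand `ν(…)` by the jumps out of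
  -- the larger superlevel set.
  refine add_le_add (ENNReal.ofReal_le_ofReal (Real.rpow_le_rpow (by positivity) ?_ hp0.le)) ?_
  · rw [pow_succ]
    refine le_trans ?_ (le_abs_self _)
    linarith
  · have hFx : MeasurableSet ((fun h => x + h) ⁻¹' {y | 2⁻¹ ^ (k + 1) ≤ g y})ᶜ :=
      (hF.preimage (measurable_const_add x)).compl
    rw [← setLIntegral_const, ← lintegral_indicator hFx]
    refine lintegral_mono fun h => ?_
    by_cases hh : h ∈ ((fun h => x + h) ⁻¹' {y | 2⁻¹ ^ (k + 1) ≤ g y})ᶜ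
    · rw [Set.indicator_of_mem hh]
      refine ENNReal.ofReal_le_ofReal (Real.rpow_le_rpow (by positivity) ?_ hp0.le)
      have hh : g (x + h) < 2⁻¹ ^ (k + 1) := not_le.1 hh
      rw [abs_sub_comm]
      refine le_trans ?_ (le_abs_self _)
      rw [pow_succ] at hh ⊢
      linarith
    · rw [Set.indicator_of_notMem hh]; exact zero_le

/-- Lower bound for the norm of a function that is at least one on a set of volume `V`, in terms
of the decay of `1 + ν(Aᶜ)` in the volume of `A`. -/
lemma nonlocalSobolevNorm_ge_of_measurable {p : ℝ} (hp : 1 ≤ p)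
    (ν : Measure (EuclideanSpace ℝ (Fin d))) [SFinite ν] {c θ V : ℝ} {H : ℝ≥0∞} (hc : 0 < c)
    (hθ : 0 < θ) (hθ1 : θ < 1) (hV : 0 < V)
    (hL : ∀ A : Set (EuclideanSpace ℝ (Fin d)), MeasurableSet A → V ≤ volume.real A →
      volume A ≠ ∞ → ENNReal.ofReal (c * (V / volume.real A) ^ θ) * H ≤ 1 + ν Aᶜ)
    {g : EuclideanSpace ℝ (Fin d) → ℝ} (hg : Measurable g)
    (hg1 : ENNReal.ofReal V ≤ volume {y | 1 ≤ g y}) :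
    ENNReal.ofReal (2 ^ (-p) * 2 ^ (-(θ * (p / (1 - θ)))) * c * V) * H ≤
      (∫⁻ x, ENNReal.ofReal (|g x| ^ p)) +
        ∫⁻ h, ∫⁻ x, ENNReal.ofReal (|g (x + h) - g x| ^ p) ∂volume ∂ν := by
  have hp0 : 0 < p := by linarith
  by_cases hN : ∫⁻ x, ENNReal.ofReal (|g x| ^ p) = ∞
  · rw [hN, top_add]; exact le_top
  set E : ℕ → Set (EuclideanSpace ℝ (Fin d)) := fun k => {y | 2⁻¹ ^ k ≤ g y} with hEdef
  have hEm : ∀ k, MeasurableSet (E k) := fun k => measurableSet_le measurable_const hg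
  have hpk : ∀ k : ℕ, ((2 : ℝ)⁻¹ ^ k) ^ p = 2 ^ (-(p * k)) := fun k => by
    rw [← Real.rpow_natCast, ← Real.rpow_mul (by norm_num), Real.inv_rpow two_pos.le,
      ← Real.rpow_neg two_pos.le, mul_comm]
  have hcheb : ∀ k : ℕ, ENNReal.ofReal (2 ^ (-(p * k))) * volume (E k) ≤
      ∫⁻ x, ENNReal.ofReal (|g x| ^ p) := fun k => by
    rw [← hpk, ← setLIntegral_const, ← lintegral_indicator (hEm k)]
    refine lintegral_mono fun x => ?_
    by_cases hx : x ∈ E k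
    · rw [Set.indicator_of_mem hx]
      exact ENNReal.ofReal_le_ofReal (Real.rpow_le_rpow (by positivity)
        (le_trans hx (le_abs_self _)) hp0.le)
    · rw [Set.indicator_of_notMem hx]; exact zero_le
  have hfin : ∀ k, volume (E k) ≠ ∞ := fun k htop => by
    have := hcheb k
    rw [htop, ENNReal.mul_top (by simp; positivity), top_le_iff] at this
    exact hN this
  have hVE : ∀ k, V ≤ volume.real (E k) := fun k => by
    rw [measureReal_def, ← ENNReal.ofReal_le_iff_le_toReal (hfin k)]
    refine hg1.trans (measure_mono fun y hy => ?_)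
    exact (pow_le_one₀ (a := (2 : ℝ)⁻¹) (by norm_num) (by norm_num)).trans (hy : 1 ≤ g y)
  have hEpos : ∀ k, 0 < volume.real (E k) := fun k => hV.trans_le (hVE k)
  obtain ⟨k, hk⟩ := exists_rpow_le_of_bounded (b := fun k => volume.real (E k) / V)
    (X := (∫⁻ x, ENNReal.ofReal (|g x| ^ p)).toReal / V) hp0 hθ hθ1
    (fun k => div_pos (hEpos k) hV) ((one_le_div hV).2 (hVE 0)) (fun k => by
      rw [← mul_div_assoc]
      gcongr
      rw [← ENNReal.ofReal_le_iff_le_toReal hN, ENNReal.ofReal_mul (by positivity),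
        ofReal_measureReal (hfin k)]
      exact hcheb k)
  refine le_trans ?_ (lintegral_add_lintegral_ge hp ν hg k
    (m := ENNReal.ofReal (c * (V / volume.real (E (k + 1))) ^ θ) * H) fun x => ?_)
  · rw [← ofReal_measureReal (hfin k), mul_right_comm _ H, ← mul_assoc,
      ← ENNReal.ofReal_mul (by have := hEpos (k + 1); positivity),
      ← ENNReal.ofReal_mul (by positivity)]
    refine mul_le_mul_left (ENNReal.ofReal_le_ofReal ?_) _
    have h1 := hEpos (k + 1)
    have hk' : 2 ^ (-(θ * (p / (1 - θ)))) * V ≤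
        2 ^ (-(p * k)) * volume.real (E k) * (V / volume.real (E (k + 1))) ^ θ := by
      rw [← inv_div (volume.real (E (k + 1))) V, Real.inv_rpow (by positivity),
        ← div_eq_mul_inv, le_div_iff₀ (by positivity), mul_right_comm, ← le_div_iff₀ hV,
        mul_div_assoc]
      exact hk
    rw [hpk]
    calc 2 ^ (-p) * 2 ^ (-(θ * (p / (1 - θ)))) * c * V
        = 2 ^ (-p) * c * (2 ^ (-(θ * (p / (1 - θ)))) * V) := by ring
      _ ≤ 2 ^ (-p) * c * (2 ^ (-(p * k)) * volume.real (E k) *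
            (V / volume.real (E (k + 1))) ^ θ) := by gcongr
      _ = _ := by
          push_cast
          rw [show -(p * ((k : ℝ) + 1)) = -p + -(p * k) by ring, Real.rpow_add two_pos]
          ring
  -- The decay hypothesis is applied to the translate of `E (k + 1)` by `-x`, which has the same
  -- volume.
  · have hvol : volume ((fun h => x + h) ⁻¹' E (k + 1)) = volume (E (k + 1)) :=
      measure_preimage_add _ _ _
    have hvr : volume.real ((fun h => x + h) ⁻¹' E (k + 1)) = volume.real (E (k + 1)) :=
      congrArg ENNReal.toReal hvol
    have := hL ((fun h => x + h) ⁻¹' E (k + 1)) ((hEm _).preimage (measurable_const_add x))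
      (hvr ▸ hVE _) (hvol ▸ hfin _)
    rwa [hvr] at this

/-- Lower bound for the capacity of a set of positive volume. -/
theorem nonlocalCapacity_ge {p : ℝ} (hp : 1 ≤ p)
    (ν : Measure (EuclideanSpace ℝ (Fin d))) [SFinite ν] {c θ V : ℝ} {H : ℝ≥0∞} (hc : 0 < c)
    (hθ : 0 < θ) (hθ1 : θ < 1) (hV : 0 < V)
    (hL : ∀ A : Set (EuclideanSpace ℝ (Fin d)), MeasurableSet A → V ≤ volume.real A →
      volume A ≠ ∞ → ENNReal.ofReal (c * (V / volume.real A) ^ θ) * H ≤ 1 + ν Aᶜ)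
    {S : Set (EuclideanSpace ℝ (Fin d))} (hS : ENNReal.ofReal V ≤ volume S) :
    ENNReal.ofReal (2 ^ (-p) * 2 ^ (-(θ * (p / (1 - θ)))) * c * V) * H ≤
      nonlocalCapacity ν p S := by
  have hp0 : 0 < p := by linarith
  refine le_iInf₂ fun f hf => ?_
  obtain ⟨⟨hfm, -⟩, hSf⟩ := hf
  set g := hfm.mk f with hgdef
  have hgm : Measurable g := hfm.stronglyMeasurable_mk.measurable
  have hfg : f =ᵐ[volume] g := hfm.ae_eq_mk
  refine le_trans ?_ (ENNReal.add_rpow_le_rpow_add _ _ hp)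
  rw [eLpNorm_rpow_eq_lintegral hp, nonlocalSeminorm_rpow hp]
  have e1 : ∫⁻ x, ENNReal.ofReal (|f x| ^ p) = ∫⁻ x, ENNReal.ofReal (|g x| ^ p) :=
    lintegral_congr_ae (by filter_upwards [hfg] with x hx; rw [hx])
  have e2 : ∀ h, ∫⁻ x, ENNReal.ofReal (|f (x + h) - f x| ^ p) =
      ∫⁻ x, ENNReal.ofReal (|g (x + h) - g x| ^ p) := fun h => by
    -- Translations preserve null sets, so passing to a measurable representative leaves the inner
    -- integral unchanged for every `h`, whatever `ν` is.
    have hfgh := (measurePreserving_add_right volume h).quasiMeasurePreserving.ae_eq_comp hfg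
    refine lintegral_congr_ae ?_
    filter_upwards [hfg, hfgh] with x hx hx'
    simp only [Function.comp_apply] at hx'
    rw [hx, hx']
  rw [e1, lintegral_congr e2]
  refine nonlocalSobolevNorm_ge_of_measurable hp ν hc hθ hθ1 hV hL hgm ?_
  refine hS.trans (measure_mono_ae ?_)
  filter_upwards [hfg] with x hx hxS
  have := interior_subset (hSf hxS)
  change 1 ≤ g x
  rw [← hx]
  exact this

end Lower

/-! ### Dyadic annuli and their volumes. -/

section Dyadic

variable {d : ℕ}

lemma concentration_anti (ν : Measure (EuclideanSpace ℝ (Fin d))) {p : ℝ} (hp : 0 ≤ p) {r s : ℝ}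
    (hr : 0 < r) (hrs : r ≤ s) : concentration ν p s ≤ concentration ν p r := by
  unfold concentration
  gcongr

/-- The dyadic annulus `{δ 2^{-j-1} ≤ |x| < δ 2^{-j}}`. -/
def dyadicAnnulus (d : ℕ) (δ : ℝ) (j : ℕ) : Set (EuclideanSpace ℝ (Fin d)) :=
  {x | δ * 2⁻¹ ^ (j + 1) ≤ ‖x‖ ∧ ‖x‖ < δ * 2⁻¹ ^ j}

lemma measurableSet_dyadicAnnulus (δ : ℝ) (j : ℕ) : MeasurableSet (dyadicAnnulus d δ j) :=
  (measurableSet_le measurable_const measurable_norm).inter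
    (measurableSet_lt measurable_norm measurable_const)

lemma disjoint_dyadicAnnulus {δ : ℝ} (hδ : 0 < δ) {i j : ℕ} (hij : i < j) :
    Disjoint (dyadicAnnulus d δ i) (dyadicAnnulus d δ j) := by
  refine Set.disjoint_left.2 fun x hi hj => ?_
  have : δ * (2 : ℝ)⁻¹ ^ j ≤ δ * 2⁻¹ ^ (i + 1) :=
    mul_le_mul_of_nonneg_left (pow_le_pow_of_le_one (by norm_num) (by norm_num) hij) hδ.le
  linarith [hi.1, hj.2]

lemma exists_mem_dyadicAnnulus {δ : ℝ} {x : EuclideanSpace ℝ (Fin d)} (hx : x ≠ 0)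
    (hxδ : ‖x‖ < δ) : ∃ j, x ∈ dyadicAnnulus d δ j := by
  have hlim : Tendsto (fun j : ℕ => δ * (2 : ℝ)⁻¹ ^ (j + 1)) atTop (𝓝 (δ * 0)) :=
    ((tendsto_pow_atTop_nhds_zero_of_lt_one (by norm_num) (by norm_num)).comp
      (tendsto_add_atTop_nat 1)).const_mul δ
  rw [mul_zero] at hlim
  have hex : ∃ j : ℕ, δ * (2 : ℝ)⁻¹ ^ (j + 1) ≤ ‖x‖ :=
    (hlim.eventually (ge_mem_nhds (norm_pos_iff.2 hx))).exists
  classical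
  refine ⟨Nat.find hex, Nat.find_spec hex, ?_⟩
  rcases h : Nat.find hex with _ | k
  · simpa using hxδ
  · exact not_le.1 (Nat.find_min hex (h ▸ Nat.lt_succ_self k))

lemma volume_real_dyadicAnnulus {δ : ℝ} (hδ : 0 < δ) (j : ℕ) :
    volume.real (dyadicAnnulus d δ j) = (1 - 2⁻¹ ^ d) *
      volume.real (Metric.ball (0 : EuclideanSpace ℝ (Fin d)) 1) * (δ * 2⁻¹ ^ j) ^ d := by
  have hball : ∀ i : ℕ, volume.real (Metric.ball (0 : EuclideanSpace ℝ (Fin d)) (δ * 2⁻¹ ^ i)) =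
      (δ * 2⁻¹ ^ i) ^ d * volume.real (Metric.ball (0 : EuclideanSpace ℝ (Fin d)) 1) := fun i => by
    rw [measureReal_def, volume_ball_eq _ (by positivity), ENNReal.toReal_ofReal (by positivity)]
  have he : dyadicAnnulus d δ j =
      Metric.ball 0 (δ * 2⁻¹ ^ j) \ Metric.ball 0 (δ * 2⁻¹ ^ (j + 1)) := by
    ext x
    simp [dyadicAnnulus, and_comm]
  rw [he, measureReal_sdiff (Metric.ball_subset_ball (by
      rw [pow_succ]; have : 0 < δ * (2 : ℝ)⁻¹ ^ j := by positivity
      linarith)) measurableSet_ball measure_ball_lt_top.ne, hball, hball, pow_succ,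
    ← mul_assoc, mul_pow (δ * 2⁻¹ ^ j)]
  ring

/-- The partial sums of a sequence of weights, shifted by a constant that makes them doubling. -/
noncomputable def shiftedSum (τ : ℝ) (w : ℕ → ℝ) (n : ℕ) : ℝ :=
  1 + w 0 / (2 ^ τ - 1) + ∑ j ∈ Finset.range n, w j

/-! ### Sums of dyadic weights, and the decay of `1 + ν(Aᶜ)`. -/

section Weights

variable {τ : ℝ} {w : ℕ → ℝ}

lemma one_le_shiftedSum (hτ : 0 < τ) (hw : ∀ j, 0 < w j) (n : ℕ) : 1 ≤ shiftedSum τ w n := by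
  have h1 : 0 < (2 : ℝ) ^ τ - 1 := by linarith [Real.one_lt_rpow one_lt_two hτ]
  have h2 : 0 ≤ ∑ j ∈ Finset.range n, w j := Finset.sum_nonneg fun j _ => (hw j).le
  have h3 : 0 < w 0 / (2 ^ τ - 1) := div_pos (hw 0) h1
  unfold shiftedSum
  linarith

lemma shiftedSum_mono (hw : ∀ j, 0 < w j) : Monotone (shiftedSum τ w) :=
  monotone_nat_of_le_succ fun n => by
    unfold shiftedSum
    rw [Finset.sum_range_succ]
    linarith [hw n]

/-- The shift `a = w 0 / (2 ^ τ - 1)` solves `a + w 0 = 2 ^ τ * a`, so it absorbs the term `w 0`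
left over when the sum is reindexed. -/
lemma shiftedSum_succ_le (hτ : 0 < τ) (hdbl : ∀ j, w (j + 1) ≤ 2 ^ τ * w j) (n : ℕ) :
    shiftedSum τ w (n + 1) ≤ 2 ^ τ * shiftedSum τ w n := by
  have h1 : 1 < (2 : ℝ) ^ τ := Real.one_lt_rpow one_lt_two hτ
  have h2 : ∑ j ∈ Finset.range n, w (j + 1) ≤ 2 ^ τ * ∑ j ∈ Finset.range n, w j := by
    rw [Finset.mul_sum]
    exact Finset.sum_le_sum fun j _ => hdbl j
  have h3 : w 0 = (2 ^ τ - 1) * (w 0 / (2 ^ τ - 1)) := by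
    rw [mul_div_cancel₀]; linarith
  unfold shiftedSum
  rw [Finset.sum_range_succ']
  nlinarith

lemma shiftedSum_add_le (hτ : 0 < τ) (hdbl : ∀ j, w (j + 1) ≤ 2 ^ τ * w j) (m i : ℕ) :
    shiftedSum τ w (m + i) ≤ (2 ^ i) ^ τ * shiftedSum τ w m := by
  induction i with
  | zero => simp
  | succ i ih =>
    calc shiftedSum τ w (m + i + 1) ≤ 2 ^ τ * shiftedSum τ w (m + i) :=
          shiftedSum_succ_le hτ hdbl _
      _ ≤ 2 ^ τ * ((2 ^ i) ^ τ * shiftedSum τ w m) := by gcongr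
      _ = (2 ^ (i + 1)) ^ τ * shiftedSum τ w m := by
          rw [pow_succ, Real.mul_rpow (by positivity) (by norm_num)]; ring

lemma weight_le_shiftedSum (hτ : 0 < τ) (hw : ∀ j, 0 < w j)
    (hdbl : ∀ j, w (j + 1) ≤ 2 ^ τ * w j) (n : ℕ) : w n ≤ 2 ^ τ * shiftedSum τ w n := by
  refine le_trans ?_ (shiftedSum_succ_le hτ hdbl n)
  have h1 := one_le_shiftedSum hτ hw n
  unfold shiftedSum at h1 ⊢
  rw [Finset.sum_range_succ]
  linarith

lemma weight_add_le (hdbl : ∀ j, w (j + 1) ≤ 2 ^ τ * w j) (n i : ℕ) :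
    w (n + i) ≤ (2 ^ τ) ^ i * w n := by
  induction i with
  | zero => simp
  | succ i ih =>
    calc w (n + i + 1) ≤ 2 ^ τ * w (n + i) := hdbl _
      _ ≤ 2 ^ τ * ((2 ^ τ) ^ i * w n) := by gcongr
      _ = _ := by ring

/-- Karamata-type upper bound of the concentration function at dyadic radii. -/
lemma exists_concentration_le {ν : Measure (EuclideanSpace ℝ (Fin d))} {p δ C₁ : ℝ}
    (hτ : 0 < τ) (hτp : τ < p) (hδ : 0 < δ) (hC₁ : 0 < C₁) (hw : ∀ j, 0 < w j)
    (hdbl : ∀ j, w (j + 1) ≤ 2 ^ τ * w j)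
    (hA : ∀ j, ν (dyadicAnnulus d δ j) ≤ ENNReal.ofReal (C₁ * w j))
    (hout : ν {x | δ ≤ ‖x‖} ≠ ∞) :
    ∃ C : ℝ, 0 < C ∧ ∀ n : ℕ, 1 + concentration ν p (δ * 2⁻¹ ^ n) ≤
      ENNReal.ofReal (C * shiftedSum τ w n) := by
  have hp0 : 0 < p := hτ.trans hτp
  -- Ratio of the geometric tail over annuli inside the radius: weights gain at most `2 ^ τ` per
  -- step while `‖x‖ ^ p` loses `2 ^ p`. Here `τ < p` is needed.
  set q : ℝ := 2 ^ τ * (2⁻¹) ^ p with hq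
  have hq0 : 0 < q := by positivity
  have hq1 : q < 1 := by
    rw [hq, Real.inv_rpow two_pos.le, ← div_eq_mul_inv, div_lt_one (by positivity)]
    exact Real.rpow_lt_rpow_of_exponent_lt one_lt_two hτp
  set K := (ν {x | δ ≤ ‖x‖}).toReal with hK
  have hK0 : 0 ≤ K := ENNReal.toReal_nonneg
  have hq1' : 0 < (1 - q)⁻¹ := inv_pos.2 (by linarith)
  refine ⟨1 + K + C₁ + C₁ * 2 ^ τ * (1 - q)⁻¹, by positivity, fun n => ?_⟩
  -- `v j` bounds the integrand on annulus `j`: the truncation `1` for `j < n`, the power of the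
  -- norm beyond.
  set v : ℕ → ℝ≥0∞ := fun j => if j < n then 1 else ENNReal.ofReal ((2⁻¹ ^ p) ^ (j - n)) with hv
  have houtm : MeasurableSet {x : EuclideanSpace ℝ (Fin d) | δ ≤ ‖x‖} :=
    measurableSet_le measurable_const measurable_norm
  have hpt : ∀ x : EuclideanSpace ℝ (Fin d),
      ENNReal.ofReal (min 1 (‖x‖ ^ p / (δ * 2⁻¹ ^ n) ^ p)) ≤
        {x | δ ≤ ‖x‖}.indicator 1 x + ∑' j, (dyadicAnnulus d δ j).indicator (fun _ => v j) x := by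
    intro x
    by_cases hx0 : x = 0
    · rw [hx0, norm_zero, Real.zero_rpow hp0.ne', zero_div, min_eq_right zero_le_one,
        ENNReal.ofReal_zero]
      exact zero_le
    by_cases hxδ : δ ≤ ‖x‖
    · refine le_trans ?_ le_self_add
      rw [Set.indicator_of_mem (show x ∈ {x | δ ≤ ‖x‖} from hxδ), Pi.one_apply,
        ENNReal.ofReal_le_one]
      exact min_le_left _ _
    obtain ⟨j, hj⟩ := exists_mem_dyadicAnnulus hx0 (not_le.1 hxδ)
    refine le_trans ?_ le_add_self
    refine le_trans ?_ (ENNReal.le_tsum j)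
    rw [Set.indicator_of_mem hj]
    simp only [hv]
    split_ifs with hjn
    · rw [ENNReal.ofReal_le_one]
      exact min_le_left _ _
    · refine ENNReal.ofReal_le_ofReal ((min_le_right _ _).trans ?_)
      rw [← Real.div_rpow (norm_nonneg _) (by positivity), ← Real.rpow_natCast (_ ^ p),
        ← Real.rpow_mul (by norm_num), mul_comm p, Real.rpow_mul (by norm_num), Real.rpow_natCast]
      refine Real.rpow_le_rpow (by positivity) ?_ hp0.le
      rw [div_le_iff₀ (by positivity), mul_left_comm, ← pow_add, Nat.sub_add_cancel (not_lt.1 hjn)]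
      exact hj.2.le
  have hint : concentration ν p (δ * 2⁻¹ ^ n) ≤
      ν {x | δ ≤ ‖x‖} + ∑' j, v j * ν (dyadicAnnulus d δ j) := by
    refine (lintegral_mono hpt).trans ?_
    rw [lintegral_add_left (measurable_one.indicator houtm), lintegral_indicator_one houtm,
      lintegral_tsum fun j =>
        (measurable_const.indicator (measurableSet_dyadicAnnulus δ j)).aemeasurable]
    gcongr with j
    rw [lintegral_indicator_const (measurableSet_dyadicAnnulus δ j)]
  have hhead : ∑ j ∈ Finset.range n, v j * ν (dyadicAnnulus d δ j) ≤
      ENNReal.ofReal (C₁ * ∑ j ∈ Finset.range n, w j) := by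
    rw [Finset.mul_sum, ENNReal.ofReal_sum_of_nonneg fun j _ => (mul_pos hC₁ (hw j)).le]
    refine Finset.sum_le_sum fun j hj => ?_
    rw [show v j = 1 from if_pos (Finset.mem_range.1 hj), one_mul]
    exact hA j
  have htail : ∑' i, v (i + n) * ν (dyadicAnnulus d δ (i + n)) ≤
      ENNReal.ofReal (C₁ * w n * (1 - q)⁻¹) := by
    have hwn := hw n
    rw [← tsum_geometric_of_lt_one hq0.le hq1, ← tsum_mul_left,
      ENNReal.ofReal_tsum_of_nonneg (fun i => by positivity)
        ((summable_geometric_of_lt_one hq0.le hq1).mul_left _)]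
    refine ENNReal.tsum_le_tsum fun i => ?_
    have hvi : v (i + n) = ENNReal.ofReal ((2⁻¹ ^ p) ^ i) := by simp [hv]
    rw [hvi]
    refine (mul_le_mul_right (hA _) _).trans ?_
    rw [← ENNReal.ofReal_mul (by positivity)]
    refine ENNReal.ofReal_le_ofReal ?_
    calc ((2 : ℝ)⁻¹ ^ p) ^ i * (C₁ * w (i + n)) ≤
          (2⁻¹ ^ p) ^ i * (C₁ * ((2 ^ τ) ^ i * w n)) := by
          gcongr; rw [add_comm]; exact weight_add_le hdbl n i
      _ = C₁ * w n * q ^ i := by rw [hq, mul_pow]; ring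
  rw [← Summable.sum_add_tsum_nat_add' (k := n) ENNReal.summable,
    ← ENNReal.ofReal_toReal hout, ← hK] at hint
  have hsum0 : 0 ≤ ∑ j ∈ Finset.range n, w j := Finset.sum_nonneg fun j _ => (hw j).le
  have hwn := (hw n).le
  calc 1 + concentration ν p (δ * 2⁻¹ ^ n)
      ≤ ENNReal.ofReal 1 + (ENNReal.ofReal K + (ENNReal.ofReal (C₁ * ∑ j ∈ Finset.range n, w j) +
          ENNReal.ofReal (C₁ * w n * (1 - q)⁻¹))) := by
        rw [ENNReal.ofReal_one]
        exact add_le_add le_rfl (hint.trans (add_le_add le_rfl (add_le_add hhead htail)))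
    _ = ENNReal.ofReal (1 + (K + (C₁ * (∑ j ∈ Finset.range n, w j) +
          C₁ * w n * (1 - q)⁻¹))) := by
        rw [← ENNReal.ofReal_add (by positivity) (by positivity),
          ← ENNReal.ofReal_add (by positivity) (by positivity),
          ← ENNReal.ofReal_add (by positivity) (by positivity)]
    _ ≤ _ := by
        refine ENNReal.ofReal_le_ofReal ?_
        have hS := one_le_shiftedSum hτ hw n
        have h1 := weight_le_shiftedSum hτ hw hdbl n
        have h2 : ∑ j ∈ Finset.range n, w j ≤ shiftedSum τ w n := by
          have := one_le_shiftedSum hτ hw 0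
          unfold shiftedSum at this ⊢
          simp only [Finset.range_zero, Finset.sum_empty] at this
          linarith
        have h3 : C₁ * w n * (1 - q)⁻¹ ≤ C₁ * (2 ^ τ * shiftedSum τ w n) * (1 - q)⁻¹ := by gcongr
        have h4 : C₁ * (∑ j ∈ Finset.range n, w j) ≤ C₁ * shiftedSum τ w n := by gcongr
        nlinarith

/-- Outside a set of small volume, `ν` retains the mass of the large annuli. -/
lemma shiftedSum_le_measure_compl {ν : Measure (EuclideanSpace ℝ (Fin d))} {δ β c₁ : ℝ}
    (hτ : 0 < τ) (hδ : 0 < δ) (hβ : 0 < β) (hc₁ : 0 < c₁) (hw : ∀ j, 0 < w j)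
    (hA : ∀ j, ∀ A : Set (EuclideanSpace ℝ (Fin d)), MeasurableSet A → volume A ≠ ∞ →
      volume.real A ≤ β * (δ * 2⁻¹ ^ j) ^ d →
      ENNReal.ofReal (c₁ * w j) ≤ ν (dyadicAnnulus d δ j \ A))
    {A : Set (EuclideanSpace ℝ (Fin d))} (hAm : MeasurableSet A) (hAfin : volume A ≠ ∞) {m : ℕ}
    (hm : 0 < m → volume.real A ≤ β * (δ * 2⁻¹ ^ m) ^ d) :
    ENNReal.ofReal (min c₁ (shiftedSum τ w 0)⁻¹ * shiftedSum τ w m) ≤ 1 + ν Aᶜ := by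
  have hS0 : 1 ≤ shiftedSum τ w 0 := one_le_shiftedSum hτ hw 0
  have hsum : ENNReal.ofReal (c₁ * ∑ j ∈ Finset.range m, w j) ≤ ν Aᶜ := by
    rw [Finset.mul_sum, ENNReal.ofReal_sum_of_nonneg fun j _ => (mul_pos hc₁ (hw j)).le]
    calc _ ≤ ∑ j ∈ Finset.range m, ν (dyadicAnnulus d δ j \ A) := by
          refine Finset.sum_le_sum fun j hj => hA j A hAm hAfin ?_
          have hjm := Finset.mem_range.1 hj
          refine (hm (by omega)).trans ?_
          gcongr ?_ * (?_ * ?_) ^ d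
          exact pow_le_pow_of_le_one (by norm_num) (by norm_num) hjm.le
      _ = ν (⋃ j ∈ Finset.range m, dyadicAnnulus d δ j \ A) := by
          refine (measure_biUnion_finset (fun i _ j _ hij => ?_)
            fun j _ => (measurableSet_dyadicAnnulus δ j).diff hAm).symm
          rcases lt_or_gt_of_ne hij with h | h
          · exact (disjoint_dyadicAnnulus hδ h).mono Set.sdiff_subset Set.sdiff_subset
          · exact (disjoint_dyadicAnnulus hδ h).symm.mono Set.sdiff_subset Set.sdiff_subset
      _ ≤ ν Aᶜ := measure_mono (Set.iUnion₂_subset fun j _ x hx => hx.2)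
  have hs : 0 ≤ ∑ j ∈ Finset.range m, w j := Finset.sum_nonneg fun j _ => (hw j).le
  have hsplit : shiftedSum τ w m = shiftedSum τ w 0 + ∑ j ∈ Finset.range m, w j := by
    simp [shiftedSum]
  -- The summand `1` covers `S 0` and the `ν`-mass covers the remaining weights, whence the minimum
  -- in the constant.
  calc _ ≤ ENNReal.ofReal (1 + c₁ * ∑ j ∈ Finset.range m, w j) := by
        refine ENNReal.ofReal_le_ofReal ?_
        rw [hsplit, mul_add]
        refine add_le_add ?_ (mul_le_mul_of_nonneg_right (min_le_left _ _) hs)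
        exact (mul_le_mul_of_nonneg_right (min_le_right _ _) (by linarith)).trans_eq
          (inv_mul_cancel₀ (by linarith))
    _ = 1 + ENNReal.ofReal (c₁ * ∑ j ∈ Finset.range m, w j) := by
        rw [ENNReal.ofReal_add zero_le_one (by positivity), ENNReal.ofReal_one]
    _ ≤ _ := by gcongr

/-- `m` is the predecessor of the first index at which `β (δ 2⁻ʲ) ^ d` drops to `v`. If that index
is `0` then `m = 0`, and the upper bound on `v` is not claimed. -/
lemma exists_scale_of_volume (hd : 1 ≤ d) {δ β v : ℝ} (hδ : 0 < δ) (hβ : 0 < β) (hv : 0 < v) :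
    ∃ m : ℕ, (0 < m → v ≤ β * (δ * 2⁻¹ ^ m) ^ d) ∧ (δ * 2⁻¹ ^ m) ^ d ≤ 2 ^ d / β * v := by
  have hlim : Tendsto (fun j : ℕ => β * (δ * (2 : ℝ)⁻¹ ^ j) ^ d) atTop (𝓝 (β * (δ * 0) ^ d)) :=
    (((tendsto_pow_atTop_nhds_zero_of_lt_one (by norm_num) (by norm_num)).const_mul δ).pow
      d).const_mul β
  rw [mul_zero, zero_pow (by omega), mul_zero] at hlim
  have hex : ∃ j : ℕ, β * (δ * (2 : ℝ)⁻¹ ^ j) ^ d ≤ v := (hlim.eventually (ge_mem_nhds hv)).exists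
  classical
  have hspec := Nat.find_spec hex
  rcases h : Nat.find hex with _ | k
  · refine ⟨0, fun h0 => absurd h0 (lt_irrefl 0), ?_⟩
    rw [h] at hspec
    rw [div_mul_eq_mul_div, le_div_iff₀ hβ, mul_comm]
    refine hspec.trans ?_
    exact le_mul_of_one_le_left hv.le (one_le_pow₀ one_le_two)
  · refine ⟨k, fun _ => (not_le.1 (Nat.find_min hex (h ▸ Nat.lt_succ_self k))).le, ?_⟩
    rw [h, pow_succ, ← mul_assoc, mul_pow _ (2⁻¹ : ℝ)] at hspec
    rw [div_mul_eq_mul_div, le_div_iff₀ hβ, mul_comm]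
    calc β * (δ * (2 : ℝ)⁻¹ ^ k) ^ d
        = 2 ^ d * (β * ((δ * 2⁻¹ ^ k) ^ d * 2⁻¹ ^ d)) := by
          rw [inv_pow 2 d]; field_simp
      _ ≤ 2 ^ d * v := by gcongr

/-- Potter-type comparison of `1 + ν(Aᶜ)` with the concentration function at a smaller scale. -/
lemma exists_concentration_le_measure_compl (hd : 1 ≤ d)
    {ν : Measure (EuclideanSpace ℝ (Fin d))} {p δ β c₁ C₁ : ℝ}
    (hτ : 0 < τ) (hτp : τ < p) (hδ : 0 < δ) (hβ : 0 < β) (hc₁ : 0 < c₁) (hC₁ : 0 < C₁)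
    (hw : ∀ j, 0 < w j) (hdbl : ∀ j, w (j + 1) ≤ 2 ^ τ * w j)
    (hub : ∀ j, ν (dyadicAnnulus d δ j) ≤ ENNReal.ofReal (C₁ * w j))
    (hout : ν {x | δ ≤ ‖x‖} ≠ ∞)
    (hlb : ∀ j, ∀ A : Set (EuclideanSpace ℝ (Fin d)), MeasurableSet A → volume A ≠ ∞ →
      volume.real A ≤ β * (δ * 2⁻¹ ^ j) ^ d →
      ENNReal.ofReal (c₁ * w j) ≤ ν (dyadicAnnulus d δ j \ A)) :
    ∃ c : ℝ, 0 < c ∧ ∀ r : ℝ, 0 < r → ∀ A : Set (EuclideanSpace ℝ (Fin d)), MeasurableSet A →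
      volume.real (Metric.ball (0 : EuclideanSpace ℝ (Fin d)) 1) * r ^ d ≤ volume.real A →
      volume A ≠ ∞ →
      ENNReal.ofReal (c * (volume.real (Metric.ball (0 : EuclideanSpace ℝ (Fin d)) 1) * r ^ d /
        volume.real A) ^ (τ / d)) * (1 + concentration ν p r) ≤ 1 + ν Aᶜ := by
  obtain ⟨C, hC, hconc⟩ := exists_concentration_le hτ hτp hδ hC₁ hw hdbl hub hout
  set ω := volume.real (Metric.ball (0 : EuclideanSpace ℝ (Fin d)) 1) with hω
  have hω0 : 0 < ω :=
    ENNReal.toReal_pos (Metric.measure_ball_pos _ _ one_pos).ne' measure_ball_lt_top.ne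
  have hd0 : (0 : ℝ) < d := by exact_mod_cast hd
  have hS := one_le_shiftedSum hτ hw
  set S := shiftedSum τ w with hSdef
  set c₂ := min c₁ (S 0)⁻¹ with hc₂
  have hc₂0 : 0 < c₂ := lt_min hc₁ (inv_pos.2 (by linarith [hS 0]))
  -- The second entry compares the volume scales when `m < n`; the `1` keeps the base at least `1`
  -- when `n ≤ m`.
  set D := max 1 (2 ^ d / β * ω) with hD
  have hD1 : 1 ≤ D := le_max_left _ _
  have hD0 : 0 < D := by linarith
  refine ⟨c₂ / (C * 2 ^ τ * D ^ (τ / d)), by positivity, fun r hr A hAm hrA hAfin => ?_⟩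
  have hV : 0 < ω * r ^ d := by positivity
  have hA0 : 0 < volume.real A := hV.trans_le hrA
  -- For `r ≤ δ`, `δ 2⁻ⁿ⁻¹ < r ≤ δ 2⁻ⁿ`, and rounding `r` down costs the factor `2 ^ τ`. For `r >
  -- δ`, `n = 0`; the bound on `r` is only used when `m < n`.
  obtain ⟨n, hn, hrn⟩ : ∃ n : ℕ, 1 + concentration ν p r ≤ ENNReal.ofReal (C * (2 ^ τ * S n)) ∧
      (0 < n → r ≤ δ * 2⁻¹ ^ n) := by
    rcases lt_or_ge δ r with h | h
    · refine ⟨0, ?_, fun h0 => absurd h0 (lt_irrefl 0)⟩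
      refine (add_le_add le_rfl (concentration_anti ν (hτ.trans hτp).le (by positivity)
        (show δ * (2⁻¹) ^ 0 ≤ r by simpa using h.le))).trans ((hconc 0).trans ?_)
      refine ENNReal.ofReal_le_ofReal (mul_le_mul_of_nonneg_left ?_ hC.le)
      exact le_mul_of_one_le_left (by linarith [hS 0]) (Real.one_le_rpow one_le_two hτ.le)
    · obtain ⟨n, hn1, hn2⟩ := exists_nat_pow_near_of_lt_one (x := r / δ) (y := (2 : ℝ)⁻¹)
        (by positivity) ((div_le_one hδ).2 h) (by norm_num) (by norm_num)
      rw [lt_div_iff₀ hδ, mul_comm] at hn1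
      rw [div_le_iff₀ hδ, mul_comm] at hn2
      refine ⟨n, (add_le_add le_rfl (concentration_anti ν (hτ.trans hτp).le (by positivity)
        hn1.le)).trans ((hconc (n + 1)).trans ?_), fun _ => hn2⟩
      exact ENNReal.ofReal_le_ofReal (mul_le_mul_of_nonneg_left
        (shiftedSum_succ_le hτ hdbl n) hC.le)
  obtain ⟨m, hm1, hm2⟩ := exists_scale_of_volume hd hδ hβ hA0
  have hcompl := shiftedSum_le_measure_compl hτ hδ hβ hc₁ hw hlb hAm hAfin hm1
  have hratio : 1 ≤ volume.real A / (ω * r ^ d) := (one_le_div hV).2 hrA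
  have hSnm : S n ≤ (D * (volume.real A / (ω * r ^ d))) ^ (τ / d) * S m := by
    rcases le_or_gt n m with h | h
    · refine (shiftedSum_mono hw h).trans (le_mul_of_one_le_left (by linarith [hS m]) ?_)
      exact Real.one_le_rpow (one_le_mul_of_one_le_of_one_le hD1 hratio) (by positivity)
    · obtain ⟨i, rfl⟩ := Nat.exists_eq_add_of_lt h
      refine (shiftedSum_add_le hτ hdbl m (i + 1)).trans ?_
      refine mul_le_mul_of_nonneg_right ?_ (by linarith [hS m])
      have hbase : ((2 : ℝ) ^ (i + 1)) ^ d ≤ D * (volume.real A / (ω * r ^ d)) := by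
        have hr' := hrn (by omega)
        calc ((2 : ℝ) ^ (i + 1)) ^ d ≤ ((δ * 2⁻¹ ^ m) / r) ^ d := by
              gcongr
              rw [le_div_iff₀ hr]
              refine (mul_le_mul_of_nonneg_left hr' (by positivity)).trans_eq ?_
              have h1 : (2 : ℝ)⁻¹ ^ (i + 1) * 2 ^ (i + 1) = 1 := by rw [← mul_pow]; norm_num
              rw [add_assoc, pow_add _ m]
              linear_combination (δ * 2⁻¹ ^ m) * h1
          _ = (δ * 2⁻¹ ^ m) ^ d / r ^ d := div_pow _ _ _
          _ ≤ 2 ^ d / β * volume.real A / r ^ d := by gcongr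
          _ = 2 ^ d / β * ω * (volume.real A / (ω * r ^ d)) := by field_simp
          _ ≤ _ := by gcongr; exact le_max_right _ _
      calc ((2 : ℝ) ^ (i + 1)) ^ τ = (((2 : ℝ) ^ (i + 1)) ^ d) ^ (τ / d) := by
            rw [← Real.rpow_natCast _ d, ← Real.rpow_mul (by positivity),
              mul_div_cancel₀ _ hd0.ne']
        _ ≤ _ := Real.rpow_le_rpow (by positivity) hbase (by positivity)
  refine (mul_le_mul_right hn _).trans ?_
  refine le_trans ?_ hcompl
  rw [← ENNReal.ofReal_mul (by positivity)]
  refine ENNReal.ofReal_le_ofReal ?_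
  have hx0 : 0 < ω * r ^ d / volume.real A := by positivity
  have hinv : volume.real A / (ω * r ^ d) = (ω * r ^ d / volume.real A)⁻¹ := (inv_div _ _).symm
  rw [hinv, Real.mul_rpow hD0.le (by positivity), Real.inv_rpow hx0.le] at hSnm
  set y := (ω * r ^ d / volume.real A) ^ (τ / d)
  have hy : 0 < y := by positivity
  calc c₂ / (C * 2 ^ τ * D ^ (τ / d)) * y * (C * (2 ^ τ * S n))
      ≤ c₂ / (C * 2 ^ τ * D ^ (τ / d)) * y * (C * (2 ^ τ * (D ^ (τ / d) * y⁻¹ * S m))) := by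
        gcongr
    _ = c₂ * S m := by field_simp

end Weights

end Dyadic

/-! ### The kernel measure on annuli. -/

section RadialKernel

variable {d : ℕ}

lemma measure_norm_ge_ne_top {ν : Measure (EuclideanSpace ℝ (Fin d))} {p δ : ℝ} (hp : 0 < p)
    (hδ : 0 < δ) (hν : PIntegrable ν p) : ν {x | δ ≤ ‖x‖} ≠ ∞ := by
  have hm : 0 < min 1 (δ ^ p) := lt_min one_pos (by positivity)
  have hle : ENNReal.ofReal (min 1 (δ ^ p)) * ν {x | δ ≤ ‖x‖} ≤
      ∫⁻ x, ENNReal.ofReal (min 1 (‖x‖ ^ p)) ∂ν := by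
    refine le_trans ?_ (mul_meas_ge_le_lintegral (by fun_prop) (ENNReal.ofReal (min 1 (δ ^ p))))
    refine mul_le_mul_right (measure_mono fun x hx => ENNReal.ofReal_le_ofReal ?_) _
    exact min_le_min le_rfl (Real.rpow_le_rpow hδ.le hx hp.le)
  intro htop
  rw [htop, ENNReal.mul_top (by simpa using hm)] at hle
  exact absurd (top_le_iff.1 hle) hν.ne

/-- Two-sided bound for the density of the kernel measure on a dyadic annulus. -/
lemma radialKernel_density_bounds {φ : ℝ → ℝ} {δ M : ℝ} (hδ : 0 < δ) (hM : 0 < M)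
    (hφ : ∀ s, 0 < s → s ≤ δ → 0 < φ s ∧
      ∀ u, 1 / 2 ≤ u → u ≤ 1 → φ (s * u) ≤ M * φ s ∧ φ s ≤ M * φ (s * u)) (j : ℕ)
    {x : EuclideanSpace ℝ (Fin d)} (hx : x ∈ dyadicAnnulus d δ j) :
    ENNReal.ofReal (M⁻¹ * (φ (δ * 2⁻¹ ^ j))⁻¹ / (δ * 2⁻¹ ^ j) ^ d) ≤
        (ENNReal.ofReal (‖x‖ ^ d))⁻¹ * (ENNReal.ofReal (φ ‖x‖))⁻¹ ∧
      (ENNReal.ofReal (‖x‖ ^ d))⁻¹ * (ENNReal.ofReal (φ ‖x‖))⁻¹ ≤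
        ENNReal.ofReal (2 ^ d * M * (φ (δ * 2⁻¹ ^ j))⁻¹ / (δ * 2⁻¹ ^ j) ^ d) := by
  obtain ⟨hx1, hx2⟩ := hx
  set s := δ * (2 : ℝ)⁻¹ ^ j with hs
  have hs0 : 0 < s := by positivity
  have hsδ : s ≤ δ := mul_le_of_le_one_right hδ.le (pow_le_one₀ (by norm_num) (by norm_num))
  have hsx : s / 2 ≤ ‖x‖ := by
    rw [pow_succ, ← mul_assoc, ← hs] at hx1
    linarith
  have hx0 : 0 < ‖x‖ := by linarith
  obtain ⟨hφs, hφu⟩ := hφ s hs0 hsδ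
  have hφx := (hφ ‖x‖ hx0 (hx2.le.trans hsδ)).1
  obtain ⟨h1, h2⟩ := hφu (‖x‖ / s) (by rw [le_div_iff₀ hs0]; linarith)
    ((div_le_one hs0).2 hx2.le)
  rw [mul_div_cancel₀ _ hs0.ne'] at h1 h2
  rw [← ENNReal.ofReal_inv_of_pos (by positivity), ← ENNReal.ofReal_inv_of_pos hφx,
    ← ENNReal.ofReal_mul (by positivity)]
  have hpow1 : ‖x‖ ^ d ≤ s ^ d := by gcongr
  have hpow2 : s ^ d ≤ 2 ^ d * ‖x‖ ^ d := by
    rw [← mul_pow]; gcongr; linarith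
  constructor <;> refine ENNReal.ofReal_le_ofReal ?_
  · calc M⁻¹ * (φ s)⁻¹ / s ^ d = (s ^ d)⁻¹ * (M * φ s)⁻¹ := by field_simp
      _ ≤ (‖x‖ ^ d)⁻¹ * (φ ‖x‖)⁻¹ := by gcongr
  · calc (‖x‖ ^ d)⁻¹ * (φ ‖x‖)⁻¹ = 2 ^ d * M * ((2 ^ d * ‖x‖ ^ d)⁻¹ * (M * φ ‖x‖)⁻¹) := by
          field_simp
      _ ≤ 2 ^ d * M * ((s ^ d)⁻¹ * (φ s)⁻¹) := by gcongr
      _ = 2 ^ d * M * (φ s)⁻¹ / s ^ d := by field_simp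

lemma radialKernelMeasure_dyadicAnnulus_le {φ : ℝ → ℝ} {δ M : ℝ} (hδ : 0 < δ) (hM : 0 < M)
    (hφ : ∀ s, 0 < s → s ≤ δ → 0 < φ s ∧
      ∀ u, 1 / 2 ≤ u → u ≤ 1 → φ (s * u) ≤ M * φ s ∧ φ s ≤ M * φ (s * u)) (j : ℕ) :
    radialKernelMeasure d φ (dyadicAnnulus d δ j) ≤ ENNReal.ofReal
      (2 ^ d * M * ((1 - 2⁻¹ ^ d) * volume.real (Metric.ball (0 : EuclideanSpace ℝ (Fin d)) 1)) *
        (φ (δ * 2⁻¹ ^ j))⁻¹) := by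
  have hfin : volume (dyadicAnnulus d δ j) ≠ ∞ :=
    ((measure_mono fun x hx => mem_ball_zero_iff.2 hx.2).trans_lt
      (measure_ball_lt_top (x := (0 : EuclideanSpace ℝ (Fin d))) (r := δ * 2⁻¹ ^ j))).ne
  have hs0 : 0 < δ * (2 : ℝ)⁻¹ ^ j := by positivity
  have hφs := (hφ (δ * 2⁻¹ ^ j) hs0
    (mul_le_of_le_one_right hδ.le (pow_le_one₀ (by norm_num) (by norm_num)))).1
  rw [radialKernelMeasure, withDensity_apply']
  refine (setLIntegral_mono_ae' (measurableSet_dyadicAnnulus δ j) (Eventually.of_forall fun x hx =>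
    (radialKernel_density_bounds hδ hM hφ j hx).2)).trans ?_
  rw [setLIntegral_const, ← ofReal_measureReal hfin, ← ENNReal.ofReal_mul (by positivity),
    volume_real_dyadicAnnulus hδ]
  refine ENNReal.ofReal_le_ofReal (le_of_eq ?_)
  field_simp

/-- `A` has at most half the volume of the annulus, and the factor `(δ 2⁻ʲ) ^ d` of what remains
cancels the one in the density. -/
lemma le_radialKernelMeasure_dyadicAnnulus_diff {φ : ℝ → ℝ} {δ M : ℝ} (hδ : 0 < δ) (hM : 0 < M)
    (hφ : ∀ s, 0 < s → s ≤ δ → 0 < φ s ∧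
      ∀ u, 1 / 2 ≤ u → u ≤ 1 → φ (s * u) ≤ M * φ s ∧ φ s ≤ M * φ (s * u)) (j : ℕ)
    {A : Set (EuclideanSpace ℝ (Fin d))} (hA : MeasurableSet A) (hAfin : volume A ≠ ∞)
    (hAv : volume.real A ≤ (1 - 2⁻¹ ^ d) *
      volume.real (Metric.ball (0 : EuclideanSpace ℝ (Fin d)) 1) / 2 * (δ * 2⁻¹ ^ j) ^ d) :
    ENNReal.ofReal (M⁻¹ * ((1 - 2⁻¹ ^ d) *
        volume.real (Metric.ball (0 : EuclideanSpace ℝ (Fin d)) 1) / 2) * (φ (δ * 2⁻¹ ^ j))⁻¹) ≤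
      radialKernelMeasure d φ (dyadicAnnulus d δ j \ A) := by
  have hfin : volume (dyadicAnnulus d δ j) ≠ ∞ :=
    ((measure_mono fun x hx => mem_ball_zero_iff.2 hx.2).trans_lt
      (measure_ball_lt_top (x := (0 : EuclideanSpace ℝ (Fin d))) (r := δ * 2⁻¹ ^ j))).ne
  have hs0 : 0 < δ * (2 : ℝ)⁻¹ ^ j := by positivity
  have hφs := (hφ (δ * 2⁻¹ ^ j) hs0
    (mul_le_of_le_one_right hδ.le (pow_le_one₀ (by norm_num) (by norm_num)))).1
  have hfin' : volume (dyadicAnnulus d δ j \ A) ≠ ∞ :=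
    ((measure_mono Set.sdiff_subset).trans_lt hfin.lt_top).ne
  have hvol : (1 - 2⁻¹ ^ d) * volume.real (Metric.ball (0 : EuclideanSpace ℝ (Fin d)) 1) / 2 *
      (δ * 2⁻¹ ^ j) ^ d ≤ volume.real (dyadicAnnulus d δ j \ A) := by
    have h1 := le_measureReal_sdiff (μ := volume) (s₁ := dyadicAnnulus d δ j) (s₂ := A) hAfin
    rw [volume_real_dyadicAnnulus hδ] at h1
    linarith
  rw [radialKernelMeasure, withDensity_apply']
  refine le_trans ?_ (setLIntegral_mono_ae' ((measurableSet_dyadicAnnulus δ j).diff hA)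
    (Eventually.of_forall fun x hx => (radialKernel_density_bounds hδ hM hφ j hx.1).1))
  rw [setLIntegral_const, ← ofReal_measureReal hfin', ← ENNReal.ofReal_mul (by positivity)]
  refine ENNReal.ofReal_le_ofReal ?_
  calc _ = M⁻¹ * (φ (δ * 2⁻¹ ^ j))⁻¹ / (δ * 2⁻¹ ^ j) ^ d * ((1 - 2⁻¹ ^ d) *
        volume.real (Metric.ball (0 : EuclideanSpace ℝ (Fin d)) 1) / 2 * (δ * 2⁻¹ ^ j) ^ d) := by
        field_simp
    _ ≤ _ := by gcongr

end RadialKernel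

/-! ### Assembly. -/

theorem mainTheorem11 (d : ℕ) (hd : 1 ≤ d) (p : ℝ) (hp : 1 ≤ p) (ρ : ℝ) (hρ : ρ < min (d : ℝ) p)
    (φ : ℝ → ℝ) (hφ_nonneg : ∀ r : ℝ, 0 < r → 0 ≤ φ r)
    (hφ_meas : Measurable (fun r : Set.Ioi (0 : ℝ) => φ r))
    (hφ : RegularlyVaryingAtZero φ ρ)
    (hν : PIntegrable (radialKernelMeasure d φ) p) :
    ∃ c C : ℝ, 0 < c ∧ 0 < C ∧
      ∀ (x : EuclideanSpace ℝ (Fin d)) (r : ℝ), 0 < r →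
        ENNReal.ofReal (c * r ^ d) * (1 + concentration (radialKernelMeasure d φ) p r) ≤
            nonlocalCapacity (radialKernelMeasure d φ) p (Metric.ball x r) ∧
          nonlocalCapacity (radialKernelMeasure d φ) p (Metric.ball x r) ≤
            ENNReal.ofReal (C * r ^ d) * (1 + concentration (radialKernelMeasure d φ) p r) := by
  have hp0 : 0 < p := by linarith
  have hd0 : (0 : ℝ) < d := by exact_mod_cast hd
  set ω := volume.real (Metric.ball (0 : EuclideanSpace ℝ (Fin d)) 1) with hω
  have hω0 : 0 < ω :=
    ENNReal.toReal_pos (Metric.measure_ball_pos _ _ one_pos).ne' measure_ball_lt_top.ne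
  -- `τ > ρ` gives the doubling of the weights, `τ > 0` lets the shift be defined, `τ < p` sums the
  -- tail, and `τ < d` makes `θ = τ / d < 1`.
  obtain ⟨τ, hτ1, hτ2⟩ := exists_between (max_lt hρ (lt_min hd0 hp0))
  obtain ⟨hρτ, hτ⟩ := max_lt_iff.1 hτ1
  obtain ⟨hτd, hτp⟩ := lt_min_iff.1 hτ2
  obtain ⟨δ₁, M, hδ₁, hM, hloc⟩ := hφ.exists_local_bounds hφ_nonneg hφ_meas
  have hhalf : ∀ᶠ r in 𝓝[>] (0 : ℝ), (2⁻¹ : ℝ) ^ τ < φ (2⁻¹ * r) / φ r :=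
    (hφ 2⁻¹ (by norm_num)).eventually (lt_mem_nhds
      (Real.rpow_lt_rpow_of_exponent_gt (by norm_num) (by norm_num) hρτ))
  obtain ⟨δ₂, hδ₂, hsub⟩ := mem_nhdsGT_iff_exists_Ioc_subset.1 hhalf
  set δ := min δ₁ δ₂ with hδdef
  have hδ : 0 < δ := lt_min hδ₁ hδ₂
  have hscale : ∀ j : ℕ, 0 < δ * (2 : ℝ)⁻¹ ^ j ∧ δ * (2 : ℝ)⁻¹ ^ j ≤ δ := fun j =>
    ⟨by positivity, mul_le_of_le_one_right hδ.le (pow_le_one₀ (by norm_num) (by norm_num))⟩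
  have hφδ : ∀ s, 0 < s → s ≤ δ → 0 < φ s ∧
      ∀ u, 1 / 2 ≤ u → u ≤ 1 → φ (s * u) ≤ M * φ s ∧ φ s ≤ M * φ (s * u) :=
    fun s hs hsδ => hloc s hs (hsδ.trans (min_le_left _ _))
  have hφpos : ∀ j : ℕ, 0 < φ (δ * 2⁻¹ ^ j) := fun j => (hφδ _ (hscale j).1 (hscale j).2).1
  have hdbl : ∀ j : ℕ, (φ (δ * 2⁻¹ ^ (j + 1)))⁻¹ ≤ 2 ^ τ * (φ (δ * 2⁻¹ ^ j))⁻¹ := fun j => by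
    have h1 : (2⁻¹ : ℝ) ^ τ < φ (2⁻¹ * (δ * 2⁻¹ ^ j)) / φ (δ * 2⁻¹ ^ j) :=
      hsub ⟨(hscale j).1, (hscale j).2.trans (min_le_right _ _)⟩
    rw [show 2⁻¹ * (δ * 2⁻¹ ^ j) = δ * (2 : ℝ)⁻¹ ^ (j + 1) by ring, lt_div_iff₀ (hφpos j)] at h1
    have h2 := hφpos j
    calc (φ (δ * 2⁻¹ ^ (j + 1)))⁻¹ ≤ (2⁻¹ ^ τ * φ (δ * 2⁻¹ ^ j))⁻¹ := by gcongr
      _ = 2 ^ τ * (φ (δ * 2⁻¹ ^ j))⁻¹ := by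
          rw [mul_inv, Real.inv_rpow two_pos.le, inv_inv]
  have hη : 0 < (1 - (2 : ℝ)⁻¹ ^ d) * ω :=
    mul_pos (sub_pos.2 (pow_lt_one₀ (by norm_num) (by norm_num) (by omega))) hω0
  obtain ⟨c₀, hc₀, hL⟩ := exists_concentration_le_measure_compl hd
    (ν := radialKernelMeasure d φ) (w := fun j => (φ (δ * 2⁻¹ ^ j))⁻¹)
    (β := (1 - 2⁻¹ ^ d) * ω / 2) (c₁ := M⁻¹ * ((1 - 2⁻¹ ^ d) * ω / 2))
    (C₁ := 2 ^ d * M * ((1 - 2⁻¹ ^ d) * ω)) hτ hτp hδ (by positivity) (by positivity)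
    (by positivity) (fun j => inv_pos.2 (hφpos j)) hdbl
    (radialKernelMeasure_dyadicAnnulus_le hδ hM hφδ) (measure_norm_ge_ne_top hp0 hδ hν)
    (fun j A hA hAfin hAv => le_radialKernelMeasure_dyadicAnnulus_diff hδ hM hφδ j hA hAfin hAv)
  have : SFinite (radialKernelMeasure d φ) := by unfold radialKernelMeasure; infer_instance
  refine ⟨2 ^ (-p) * 2 ^ (-(τ / d * (p / (1 - τ / d)))) * c₀ * ω, 2 ^ (2 * p) * 2 ^ d * ω,
    by positivity, by positivity, fun x r hr => ⟨?_, nonlocalCapacity_ball_le hp _ x hr⟩⟩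
  rw [mul_assoc _ ω]
  exact nonlocalCapacity_ge hp _ hc₀ (by positivity) ((div_lt_one hd0).2 hτd) (by positivity)
    (hL r hr) (by rw [volume_ball_eq x hr, mul_comm])
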